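/- A skew (left) brace is a set $B$ with two group structures $(B,+)$ and $(B,\cdot)$, neither assumed commutative, such that $a(b+c)=ab-a+ac$ for all $a,b,c\in B$; the two identity elements then coincide and are denoted by $0$. For $a\in B$ let $\lambda_a\in\operatorname{Aut}(B,+)$ be given by $\lambda_a(b)=-a+ab$. An ideal of $B$ is a subset that is a normal subgroup of both $(B,+)$ and $(B,\cdot)$ and is mapped into itself by every $\lambda_b$, $b\in B$. The cosets $b+I=bI$ of an ideal $I$ form a skew brace $B/I$. The socle of $B$ is the ideal $\operatorname{Soc}(B)=\operatorname{Ker}\lambda\cap Z(B,+)$, where $Z(B,+)$ is the centre of $(B,+)$. Put $\operatorname{Soc}_0(B)=\{0\}$ and let $\operatorname{Soc}_{n+1}(B)$ be the ideal of $B$ with $\operatorname{Soc}_{n+1}(B)/\operatorname{Soc}_n(B)=\operatorname{Soc}\big(B/\operatorname{Soc}_n(B)\big)$ for every integer $n\ge 0$; $B$ has finite multipermutational level if $B=\operatorname{Soc}_n(B)$ for some integer $n\ge 0$. Finally, $B$ is supersoluble if it has a finite chain of ideals $\{0\}=I_0\leq I_1\leq\cdots\leq I_n=B$ such that, for all $0\le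 i<n$, either $(I_{i+1}/I_i,+)$ is infinite cyclic and $I_{i+1}/I_i\leq\operatorname{Soc}(B/I_i)$, or $I_{i+1}/I_i$ has prime order. **Theorem.** Let $B$ be a supersoluble skew brace. Then $(B,+)$ is nilpotent if and only if there is an integer $n\ge 0$ such that $B=\operatorname{Soc}_n(B)$, that is, if and only if $B$ has finite multipermutational level. -/

import Mathlib

/-- A skew left brace: a set with two group structures `(B, +)` and `(B, *)`, the additive one not
necessarily commutative, such that `a * (b + c) = a * b - a + a * c`. -/
class SkewBrace (B : Type*) extends AddGroup B, Group B where
  mul_add_eq : ∀ a b c : B, a * (b + c) = a * b + -a + a * c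

namespace SkewBrace

section Basic

variable {B : Type*} [SkewBrace B]

/-- The two identity elements of a skew brace coincide. -/
theorem one_eq_zero : (1 : B) = 0 := by
  have h := mul_add_eq (1 : B) 0 0
  simpa using h

theorem mul_zero_eq (a : B) : a * 0 = a := by
  rw [← one_eq_zero, mul_one]

/-- The additive automorphism `λ_a : b ↦ -a + a * b`. -/
def lambda (a : B) : B ≃+ B where
  toFun b := -a + a * b
  invFun b := a⁻¹ * (a + b)
  left_inv b := by simp
  right_inv b := by simp
  map_add' b c := by
    rw [mul_add_eq]
    simp only [add_assoc]

theorem lambda_apply (a b : B) : lambda a b = -a + a * b := rfl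

theorem mul_eq_add_lambda (a b : B) : a * b = a + lambda a b := by
  rw [lambda_apply, add_neg_cancel_left a]

theorem lambda_one (b : B) : lambda 1 b = b := by
  rw [lambda_apply, one_mul, one_eq_zero, neg_zero, zero_add]

/-- `λ` is a homomorphism from `(B, *)` to the automorphism group of `(B, +)`. -/
theorem lambda_mul (a c b : B) : lambda (a * c) b = lambda a (lambda c b) := by
  apply add_left_cancel (a := a * c)
  rw [← mul_eq_add_lambda, mul_assoc, mul_eq_add_lambda a (c * b), mul_eq_add_lambda c b, map_add,
    ← add_assoc, ← mul_eq_add_lambda]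

theorem lambda_inv_apply_self (a b : B) : lambda a⁻¹ (lambda a b) = b := by
  rw [← lambda_mul, inv_mul_cancel, lambda_one]

/-- The kernel of `λ`. -/
def lambdaKer (B : Type*) [SkewBrace B] : Subgroup B where
  carrier := {a | ∀ b : B, lambda a b = b}
  one_mem' := lambda_one
  mul_mem' := fun {a c} ha hc b => by rw [lambda_mul, hc b, ha b]
  inv_mem' := fun {a} ha b => by
    have h := lambda_inv_apply_self a b
    rwa [ha b] at h

theorem conj_mem_lambdaKer {a : B} (ha : a ∈ lambdaKer B) (b : B) : b * a * b⁻¹ ∈ lambdaKer B := by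
  intro c
  rw [lambda_mul, lambda_mul, ha, ← lambda_mul, mul_inv_cancel, lambda_one]

end Basic

/-- An ideal of a skew brace `B`: a subset that is a normal subgroup of `(B, +)` and of `(B, *)`
and is invariant under every `λ_b`. -/
structure BraceIdeal (B : Type*) [SkewBrace B] extends AddSubgroup B, Subgroup B where
  lambda_mem' : ∀ (b : B) {a : B}, a ∈ carrier → lambda b a ∈ carrier
  add_conj_mem' : ∀ (b : B) {a : B}, a ∈ carrier → b + a + -b ∈ carrier
  mul_conj_mem' : ∀ (b : B) {a : B}, a ∈ carrier → b * a * b⁻¹ ∈ carrier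

namespace BraceIdeal

variable {B : Type*} [SkewBrace B]

instance : SetLike (BraceIdeal B) B where
  coe I := I.carrier
  coe_injective I J h := by
    obtain ⟨⟨⟨⟨_, _⟩, _⟩, _⟩, _, _, _, _, _⟩ := I
    obtain ⟨⟨⟨⟨_, _⟩, _⟩, _⟩, _, _, _, _, _⟩ := J
    cases h
    rfl

/-- Ideals are ordered by inclusion. -/
instance : PartialOrder (BraceIdeal B) := .ofSetLike (BraceIdeal B) B

instance (I : BraceIdeal B) : I.toAddSubgroup.Normal :=
  ⟨fun _ ha b => I.add_conj_mem' b ha⟩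

/-- The zero ideal. -/
instance : Bot (BraceIdeal B) where
  bot :=
    { (⊥ : AddSubgroup B) with
      carrier := {0}
      mul_mem' := by
        rintro _ _ rfl rfl
        exact mul_zero_eq _
      one_mem' := one_eq_zero
      inv_mem' := by
        rintro _ rfl
        rw [← one_eq_zero]
        exact inv_one
      lambda_mem' := by
        rintro b _ rfl
        exact map_zero _
      add_conj_mem' := by
        rintro b _ rfl
        simp
      mul_conj_mem' := by
        rintro b _ rfl
        simp [mul_zero_eq, one_eq_zero] }

/-- The whole skew brace as an ideal. -/
instance : Top (BraceIdeal B) where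
  top :=
    { (⊤ : AddSubgroup B) with
      carrier := Set.univ
      mul_mem' := fun _ _ => trivial
      one_mem' := trivial
      inv_mem' := fun _ => trivial
      lambda_mem' := fun _ _ _ => trivial
      add_conj_mem' := fun _ _ _ => trivial
      mul_conj_mem' := fun _ _ _ => trivial }

/-- The left cosets `a + I` and `a * I` agree. -/
theorem neg_add_mem_iff (I : BraceIdeal B) (a b : B) :
    -a + b ∈ I.carrier ↔ a⁻¹ * b ∈ I.carrier := by
  have key : lambda a (a⁻¹ * b) = -a + b := by simp [lambda_apply]
  constructor
  · intro h
    have h1 := I.lambda_mem' a⁻¹ h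
    rwa [← key, lambda_inv_apply_self] at h1
  · intro h
    rw [← key]
    exact I.lambda_mem' a h

/-- The underlying set of the quotient skew brace `B / I`: the set of cosets `a + I = a * I`. -/
def Quotient (I : BraceIdeal B) : Type _ := B ⧸ I.toAddSubgroup

/-- The canonical projection `B → B / I`. -/
def proj (I : BraceIdeal B) (a : B) : I.Quotient := QuotientAddGroup.mk a

theorem proj_surjective (I : BraceIdeal B) : Function.Surjective I.proj :=
  QuotientAddGroup.mk_surjective

theorem proj_eq_proj_iff (I : BraceIdeal B) {a b : B} : I.proj a = I.proj b ↔ -a + b ∈ I.carrier :=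
  QuotientAddGroup.eq

instance (I : BraceIdeal B) : AddGroup I.Quotient :=
  inferInstanceAs (AddGroup (B ⧸ I.toAddSubgroup))

/-- Multiplication of cosets: `(a + I) * (b + I) = a * b + I`. -/
instance (I : BraceIdeal B) : Mul I.Quotient where
  mul := Quotient.map₂ (fun a b : B => a * b) (by
    intro a a' ha b b' hb
    have ha' := (I.neg_add_mem_iff a a').1 (QuotientAddGroup.leftRel_apply.1 ha)
    have hb' := (I.neg_add_mem_iff b b').1 (QuotientAddGroup.leftRel_apply.1 hb)
    refine QuotientAddGroup.leftRel_apply.2 ((I.neg_add_mem_iff (a * b) (a' * b')).2 ?_)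
    have h1 := I.mul_mem' (I.mul_conj_mem' b⁻¹ ha') hb'
    have h2 : b⁻¹ * (a⁻¹ * a') * b⁻¹⁻¹ * (b⁻¹ * b') = (a * b)⁻¹ * (a' * b') := by group
    rwa [h2] at h1)

instance (I : BraceIdeal B) : One I.Quotient := ⟨I.proj 1⟩

/-- Inversion of cosets: `(a + I)⁻¹ = a⁻¹ + I`. -/
instance (I : BraceIdeal B) : Inv I.Quotient where
  inv := Quotient.map (fun a : B => a⁻¹) (by
    intro a a' ha
    have ha' := (I.neg_add_mem_iff a a').1 (QuotientAddGroup.leftRel_apply.1 ha)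
    refine QuotientAddGroup.leftRel_apply.2 ((I.neg_add_mem_iff a⁻¹ a'⁻¹).2 ?_)
    have h1 := I.mul_conj_mem' a (I.inv_mem' ha')
    have h2 : a * (a⁻¹ * a')⁻¹ * a⁻¹ = a⁻¹⁻¹ * a'⁻¹ := by group
    rwa [h2] at h1)

theorem proj_add (I : BraceIdeal B) (a b : B) : I.proj (a + b) = I.proj a + I.proj b := rfl
theorem proj_neg (I : BraceIdeal B) (a : B) : I.proj (-a) = -I.proj a := rfl
theorem proj_zero (I : BraceIdeal B) : I.proj 0 = 0 := rfl
theorem proj_mul (I : BraceIdeal B) (a b : B) : I.proj (a * b) = I.proj a * I.proj b := rfl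
theorem proj_inv (I : BraceIdeal B) (a : B) : I.proj a⁻¹ = (I.proj a)⁻¹ := rfl
theorem proj_one (I : BraceIdeal B) : I.proj 1 = 1 := rfl

/-- The quotient of a skew brace by an ideal is a skew brace. -/
instance (I : BraceIdeal B) : SkewBrace I.Quotient :=
  { (inferInstance : AddGroup I.Quotient),
    Group.ofLeftAxioms (G := I.Quotient)
      (by
        intro x y z
        obtain ⟨a, rfl⟩ := I.proj_surjective x
        obtain ⟨b, rfl⟩ := I.proj_surjective y
        obtain ⟨c, rfl⟩ := I.proj_surjective z
        simp only [← proj_mul, mul_assoc])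
      (by
        intro x
        obtain ⟨a, rfl⟩ := I.proj_surjective x
        simp only [← proj_one, ← proj_mul, one_mul])
      (by
        intro x
        obtain ⟨a, rfl⟩ := I.proj_surjective x
        simp only [← proj_one, ← proj_mul, ← proj_inv, inv_mul_cancel]) with
    mul_add_eq := by
      intro x y z
      obtain ⟨a, rfl⟩ := I.proj_surjective x
      obtain ⟨b, rfl⟩ := I.proj_surjective y
      obtain ⟨c, rfl⟩ := I.proj_surjective z
      exact congrArg I.proj (mul_add_eq a b c) }

theorem proj_lambda (I : BraceIdeal B) (a b : B) :
    I.proj (lambda a b) = lambda (I.proj a) (I.proj b) := rfl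

/-- The preimage in `B` of an ideal of `B / I`. -/
def preimage (I : BraceIdeal B) (J : BraceIdeal I.Quotient) : BraceIdeal B where
  carrier := {a | I.proj a ∈ J.carrier}
  add_mem' := fun ha hb => J.add_mem' ha hb
  zero_mem' := J.zero_mem'
  neg_mem' := fun ha => J.neg_mem' ha
  mul_mem' := fun ha hb => J.mul_mem' ha hb
  one_mem' := J.one_mem'
  inv_mem' := fun ha => J.inv_mem' ha
  lambda_mem' := fun b _ ha => J.lambda_mem' (I.proj b) ha
  add_conj_mem' := fun b _ ha => J.add_conj_mem' (I.proj b) ha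
  mul_conj_mem' := fun b _ ha => J.mul_conj_mem' (I.proj b) ha

/-- For `I ≤ J`, the factor `J / I`, as an additive subgroup of `B / I`. -/
def factor (I J : BraceIdeal B) : AddSubgroup I.Quotient where
  carrier := I.proj '' J.carrier
  add_mem' := by
    rintro _ _ ⟨a, ha, rfl⟩ ⟨b, hb, rfl⟩
    exact ⟨a + b, J.add_mem' ha hb, rfl⟩
  zero_mem' := ⟨0, J.zero_mem', rfl⟩
  neg_mem' := by
    rintro _ ⟨a, ha, rfl⟩
    exact ⟨-a, J.neg_mem' ha, rfl⟩

end BraceIdeal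

section Socle

variable {B : Type*} [SkewBrace B]

theorem mul_eq_add_of_mem_ker {a : B} (ha : a ∈ lambdaKer B) (b : B) : a * b = a + b := by
  rw [mul_eq_add_lambda, ha b]

theorem neg_eq_inv_of_mem_ker {a : B} (ha : a ∈ lambdaKer B) : -a = a⁻¹ := by
  have h := mul_eq_add_of_mem_ker ha a⁻¹
  rw [mul_inv_cancel, one_eq_zero] at h
  exact neg_eq_of_add_eq_zero_right h.symm

theorem lambda_mem_center {a : B} (ha : a ∈ AddSubgroup.center B) (b : B) :
    lambda b a ∈ AddSubgroup.center B := by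
  rw [AddSubgroup.mem_center_iff] at ha ⊢
  intro c
  obtain ⟨d, rfl⟩ := (lambda b).surjective c
  rw [← map_add, ha d, map_add]

theorem conj_eq_lambda {a : B} (ha : a ∈ lambdaKer B) (hc : a ∈ AddSubgroup.center B) (b : B) :
    b * a * b⁻¹ = lambda b a := by
  have h1 := AddSubgroup.mem_center_iff.1 (lambda_mem_center hc b) b
  rw [mul_assoc, mul_eq_add_of_mem_ker ha, mul_add_eq, mul_inv_cancel, one_eq_zero, add_zero,
    mul_eq_add_lambda b a, h1, add_neg_cancel_right]

/-- The socle `Soc(B) = Ker λ ∩ Z(B, +)`, an ideal of `B`. -/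
def socle (B : Type*) [SkewBrace B] : BraceIdeal B where
  carrier := {a | a ∈ lambdaKer B ∧ a ∈ AddSubgroup.center B}
  add_mem' := fun {a b} ha hb =>
    ⟨mul_eq_add_of_mem_ker ha.1 b ▸ mul_mem ha.1 hb.1, add_mem ha.2 hb.2⟩
  zero_mem' := ⟨one_eq_zero (B := B) ▸ one_mem _, zero_mem _⟩
  neg_mem' := fun {a} ha => ⟨neg_eq_inv_of_mem_ker ha.1 ▸ inv_mem ha.1, neg_mem ha.2⟩
  mul_mem' := fun {a b} ha hb =>
    ⟨mul_mem ha.1 hb.1, (mul_eq_add_of_mem_ker ha.1 b).symm ▸ add_mem ha.2 hb.2⟩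
  one_mem' := ⟨one_mem _, (one_eq_zero (B := B)).symm ▸ zero_mem _⟩
  inv_mem' := fun {a} ha => ⟨inv_mem ha.1, neg_eq_inv_of_mem_ker ha.1 ▸ neg_mem ha.2⟩
  lambda_mem' := fun b {a} ha =>
    ⟨conj_eq_lambda ha.1 ha.2 b ▸ conj_mem_lambdaKer ha.1 b,
      lambda_mem_center ha.2 b⟩
  add_conj_mem' := fun b {a} ha => by
    have h : b + a + -b = a := by
      rw [AddSubgroup.mem_center_iff.1 ha.2 b, add_neg_cancel_right]
    rwa [h]
  mul_conj_mem' := fun b {a} ha =>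
    ⟨conj_mem_lambdaKer ha.1 b,
      (conj_eq_lambda ha.1 ha.2 b).symm ▸ lambda_mem_center ha.2 b⟩

/-- The finite part of the upper socle series: `Soc_0(B) = {0}`, and `Soc_{n+1}(B)` is the ideal
with `Soc_{n+1}(B) / Soc_n(B) = Soc(B / Soc_n(B))`. -/
def socleSeries (B : Type*) [SkewBrace B] : ℕ → BraceIdeal B
  | 0 => ⊥
  | n + 1 => (socleSeries B n).preimage (socle (socleSeries B n).Quotient)

/-- `B` is supersoluble if it has a finite chain of ideals `{0} = I_0 ≤ I_1 ≤ ⋯ ≤ I_n = B` such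
that each factor `I_{i+1} / I_i` either is additively infinite cyclic and contained in
`Soc(B / I_i)`, or has prime order. -/
def IsSupersoluble (B : Type*) [SkewBrace B] : Prop :=
  ∃ (n : ℕ) (I : ℕ → BraceIdeal B), I 0 = ⊥ ∧ I n = ⊤ ∧
    ∀ i < n, I i ≤ I (i + 1) ∧
      ((IsAddCyclic ((I i).factor (I (i + 1))) ∧ Infinite ((I i).factor (I (i + 1))) ∧
          ∀ x ∈ (I i).factor (I (i + 1)), x ∈ socle (I i).Quotient) ∨
        (Nat.card ((I i).factor (I (i + 1)))).Prime)

end Socle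

end SkewBrace

/-! Suppose (B,+) is nilpotent. The point is that every factor F of the given chain lies in the
socle of B/I, so the chain stays below the socle series. Only prime order needs an argument. A
nontrivial normal subgroup of a nilpotent group meets the centre, so F is central. For a in F, the
map b ↦ -b + λ_a(b) is then a homomorphism into F (`lambdaDefect`), hence zero or onto. If onto, it
takes the value -a at some c, so ac = a + λ_a(c) = a + c - a = c and a is the identity; either way
λ_a is trivial. Conversely, socles are additively central, so the socle series is an ascending
central series of (B,+). -/

/-- A normal additive subgroup of a nilpotent group that meets the centre trivially is trivial. -/
theorem AddSubgroup.eq_bot_of_inf_center_eq_bot {G : Type*} [AddGroup G] [AddGroup.IsNilpotent G]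
    {F : AddSubgroup G} (hF : F.Normal) (h : F ⊓ AddSubgroup.center G = ⊥) : F = ⊥ := by
  have key : ∀ n : ℕ, F ⊓ AddSubgroup.upperCentralSeries G n = ⊥ := by
    intro n
    induction n with
    | zero => simp
    | succ n ih =>
      refine (AddSubgroup.eq_bot_iff_forall _).2 fun x hx => ?_
      refine (AddSubgroup.eq_bot_iff_forall _).1 h x ⟨hx.1, AddSubgroup.mem_center_iff.2 fun g => ?_⟩
      -- The commutator of x with g lies in F by normality and one step down the central series, so
      -- induction kills it.
      have h1 : x + g + -x + -g ∈ F ⊓ AddSubgroup.upperCentralSeries G n := by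
        refine ⟨?_, AddSubgroup.mem_upperCentralSeries_succ_iff.1 hx.2 g⟩
        have h2 := add_mem hx.1 (hF.conj_mem _ (neg_mem hx.1) g)
        rwa [← add_assoc, ← add_assoc] at h2
      rw [ih, AddSubgroup.mem_bot, add_assoc, ← neg_add_rev, add_neg_eq_zero] at h1
      exact h1.symm
  obtain ⟨n, hn⟩ := AddGroup.IsNilpotent.nilpotent G
  simpa [hn] using key n

/-- A normal additive subgroup of prime order of a nilpotent group is central. -/
theorem AddSubgroup.le_center_of_prime_card {G : Type*} [AddGroup G] [AddGroup.IsNilpotent G]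
    {F : AddSubgroup G} (hF : F.Normal) (hp : (Nat.card F).Prime) :
    F ≤ AddSubgroup.center G := by
  have : Fact (Nat.card F).Prime := ⟨hp⟩
  rcases ((AddSubgroup.center G).addSubgroupOf F).eq_bot_or_eq_top_of_prime_card with h | h
  · have h1 := AddSubgroup.eq_bot_of_inf_center_eq_bot hF
      (disjoint_iff.1 (AddSubgroup.addSubgroupOf_eq_bot.1 h).symm)
    subst h1
    simp [Nat.not_prime_one] at hp
  · exact AddSubgroup.addSubgroupOf_eq_top.1 h

namespace SkewBrace

variable {B : Type*} [SkewBrace B]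

theorem mem_socle_iff {a : B} :
    a ∈ socle B ↔ (∀ b, lambda a b = b) ∧ ∀ b, b + a = a + b :=
  and_congr Iff.rfl AddSubgroup.mem_center_iff

/-- For `a` in a central additive subgroup `F` containing all `-b + λ_a(b)`, the map
`b ↦ -b + λ_a(b)` is additive. -/
def lambdaDefect (F : AddSubgroup B) (hF : F ≤ AddSubgroup.center B) (a : B)
    (ha : ∀ b, -b + lambda a b ∈ F) : B →+ F :=
  AddMonoidHom.mk' (fun b => ⟨-b + lambda a b, ha b⟩) fun b c => Subtype.ext <| by
    change -(b + c) + lambda a (b + c) = -b + lambda a b + (-c + lambda a c)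
    -- Additivity amounts to moving -c past the central value at b.
    have h := AddSubgroup.mem_center_iff.1 (hF (ha b)) (-c)
    rw [← add_assoc (-b + lambda a b), ← h, map_add, neg_add_rev]
    simp only [add_assoc]

/-- A central additive subgroup of prime order containing `-b + λ_a(b)` for all its elements `a`
lies in the socle. -/
theorem mem_socle_of_prime_card {F : AddSubgroup B} (hp : (Nat.card F).Prime)
    (hF : F ≤ AddSubgroup.center B) (hl : ∀ a ∈ F, ∀ b, -b + lambda a b ∈ F) {a : B}
    (ha : a ∈ F) : a ∈ socle B := by
  have : Fact (Nat.card F).Prime := ⟨hp⟩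
  refine ⟨fun b => ?_, hF ha⟩
  rcases (lambdaDefect F hF a (hl a ha)).range.eq_bot_or_eq_top_of_prime_card with h | h
  · have h1 : (lambdaDefect F hF a (hl a ha)) b = 0 := by
      rw [AddMonoidHom.range_eq_bot_iff.1 h, AddMonoidHom.zero_apply]
    exact (neg_add_eq_zero.1 (congrArg Subtype.val h1)).symm
  · obtain ⟨c, hc⟩ := AddMonoidHom.range_eq_top.1 h ⟨-a, neg_mem ha⟩
    have h1 : -c + lambda a c = -a := congrArg Subtype.val hc
    have h2 : a * c = c := by
      rw [mul_eq_add_lambda, eq_add_of_neg_add_eq h1, ← add_assoc,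
        ← AddSubgroup.mem_center_iff.1 (hF ha) c, add_neg_cancel_right]
    rw [mul_eq_right.1 h2, lambda_one]

namespace BraceIdeal

/-- An ideal contains `-b + λ_a(b)` for all its elements `a`. -/
theorem neg_add_lambda_mem (J : BraceIdeal B) {a : B} (ha : a ∈ J.carrier) (b : B) :
    -b + lambda a b ∈ J.carrier := by
  -- Here λ_b(b⁻¹ab) = -b + ab, so the sum is an additive conjugate of -a plus a λ-image of a
  -- multiplicative conjugate of a.
  have h : -b + lambda a b = -b + -a + - -b + lambda b (b⁻¹ * a * b⁻¹⁻¹) := by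
    simp only [lambda_apply, inv_inv, mul_assoc, mul_inv_cancel_left, neg_neg, add_assoc,
      add_neg_cancel_left]
  rw [h]
  exact J.add_mem' (J.add_conj_mem' _ (J.neg_mem' ha)) (J.lambda_mem' b (J.mul_conj_mem' _ ha))

/-- In this form the condition is visibly monotone in I, which drives the comparison with the socle
series. -/
theorem proj_mem_socle_iff (I : BraceIdeal B) {a : B} :
    I.proj a ∈ socle I.Quotient ↔
      (∀ b, -b + lambda a b ∈ I.carrier) ∧ ∀ b, -(b + a) + (a + b) ∈ I.carrier := by
  rw [mem_socle_iff, I.proj_surjective.forall, I.proj_surjective.forall]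
  refine and_congr (forall_congr' fun b => ?_) (forall_congr' fun b => ?_)
  · rw [← proj_lambda, eq_comm, proj_eq_proj_iff]
  · rw [← proj_add, ← proj_add, proj_eq_proj_iff]

theorem factor_normal (I J : BraceIdeal B) : (I.factor J).Normal where
  conj_mem := by
    rintro _ ⟨a, ha, rfl⟩ y
    obtain ⟨b, rfl⟩ := I.proj_surjective y
    exact ⟨b + a + -b, J.add_conj_mem' b ha, rfl⟩

theorem isNilpotent_quotient (I : BraceIdeal B) [AddGroup.IsNilpotent B] :
    AddGroup.IsNilpotent I.Quotient :=
  inferInstanceAs (AddGroup.IsNilpotent (B ⧸ I.toAddSubgroup))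

/-- If `(B, +)` is nilpotent, factors of prime order of ideals are contained in the socle. -/
theorem mem_socle_of_prime_card_factor [AddGroup.IsNilpotent B] {I J : BraceIdeal B}
    (hp : (Nat.card (I.factor J)).Prime) {x : I.Quotient} (hx : x ∈ I.factor J) :
    x ∈ socle I.Quotient := by
  have := I.isNilpotent_quotient
  refine mem_socle_of_prime_card hp
    (AddSubgroup.le_center_of_prime_card (I.factor_normal J) hp) ?_ hx
  rintro _ ⟨a, ha, rfl⟩ y
  obtain ⟨b, rfl⟩ := I.proj_surjective y
  exact ⟨-b + lambda a b, J.neg_add_lambda_mem ha b, rfl⟩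

end BraceIdeal

/-- The socle series dominates every ascending series of ideals with factors in the socles. -/
theorem le_socleSeries {n : ℕ} {I : ℕ → BraceIdeal B} (h0 : I 0 = ⊥)
    (h : ∀ i < n, ∀ x ∈ (I i).factor (I (i + 1)), x ∈ socle (I i).Quotient) :
    ∀ i ≤ n, I i ≤ socleSeries B i := by
  intro i
  induction i with
  | zero => exact fun _ => h0.le
  | succ i ih =>
    intro hi a ha
    obtain ⟨h1, h2⟩ := (I i).proj_mem_socle_iff.1 (h i hi _ ⟨a, ha, rfl⟩)
    exact (socleSeries B i).proj_mem_socle_iff.2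
      ⟨fun b => ih (Nat.le_of_succ_le hi) (h1 b), fun b => ih (Nat.le_of_succ_le hi) (h2 b)⟩

/-- The additive groups of the socle series form an ascending central series. -/
theorem isAscendingCentralSeries_socleSeries :
    AddSubgroup.IsAscendingCentralSeries fun n => (socleSeries B n).toAddSubgroup := by
  refine ⟨rfl, fun x n hx g => ?_⟩
  -- Conjugation by g + x turns -(g + x) + (x + g) into the commutator required by the definition of
  -- a central series.
  have h := (socleSeries B n).add_conj_mem' (g + x)
    (((socleSeries B n).proj_mem_socle_iff.1 hx).2 g)
  have h1 : g + x + (-(g + x) + (x + g)) + -(g + x) = x + g + -x + -g := by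
    simp only [neg_add_rev, add_assoc, add_neg_cancel_left]
  rwa [h1] at h

end SkewBrace

/-- A supersoluble skew brace has nilpotent additive group if and only if it has finite
multipermutational level. -/
theorem theorem3p21 {B : Type*} [SkewBrace B] (hB : SkewBrace.IsSupersoluble B) :
    AddGroup.IsNilpotent B ↔ ∃ n : ℕ, SkewBrace.socleSeries B n = ⊤ := by
  constructor
  · intro _
    obtain ⟨n, I, h0, hn, hI⟩ := hB
    have h := SkewBrace.le_socleSeries h0 (n := n) (fun i hi x hx =>
      (hI i hi).2.elim (fun hc => hc.2.2 x hx)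
        fun hp => SkewBrace.BraceIdeal.mem_socle_of_prime_card_factor hp hx) n le_rfl
    refine ⟨n, le_antisymm (fun _ _ => trivial) ?_⟩
    rwa [hn] at h
  · rintro ⟨n, hn⟩
    refine AddSubgroup.nilpotent_iff_finite_ascending_central_series B |>.2
      ⟨n, _, SkewBrace.isAscendingCentralSeries_socleSeries, ?_⟩
    rw [hn]
    rfl
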